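/- Let $N\ge 2$ be an integer and $\beta>0$. Let $S^{N-1}$ be the unit sphere of $\mathbb R^N$ with its surface measure $\mathcal H^{N-1}$, and for $k\ge 0$ let $\mathcal S_k$ be the space of $k$-th spherical harmonics, i.e. of the restrictions to $S^{N-1}$ of the real harmonic homogeneous polynomials of degree $k$ in $N$ variables. For bounded measurable $u:S^{N-1}\to\mathbb R$ and $\omega\in S^{N-1}$ put $$\mathcal K_\beta[u](\omega)=2^{-\frac{\beta}{2}}\int_{S^{N-1}}|\omega-\xi|^{\beta}u(\xi)\,d\mathcal H^{N-1}(\xi),\qquad \mathcal I_\beta[u](\omega)=2\int_{S^{N-1}}|\omega-\xi|^{\beta}\,(u(\omega)-u(\xi))\,d\mathcal H^{N-1}(\xi).$$ For $k\ge0$ put $$\theta_{k,\beta}=(N-1)\,\omega_{N-1}\,(-1)^k\,\frac{2^{\frac{\beta+2N-4}{2}}\,\Gamma\left(\frac{\beta+N-1}{2}\right)\Gamma\left(\frac{N-1}{2}\right)\Gamma\left(\frac{\beta+2}{2}\right)}{\Gamma\left(\frac{\beta+2}{2}-k\right)\Gamma\left(\frac{\beta+2N-2}{2}+k\right)},\qquad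 \lambda_{k,\beta}=2^{1+\frac{\beta}{2}}\left(\theta_{0,\beta}-\theta_{k,\beta}\right),$$ where $\omega_{N-1}$ is the Lebesgue measure of the unit ball of $\mathbb R^{N-1}$ and $1/\Gamma$ is understood to be $0$ at $0,-1,-2,\dots$ (so that $\theta_{k,\beta}=0$ if $\beta/2$ is an integer smaller than $k$). Then for every $k\ge 0$, every $Y_k\in\mathcal S_k$ and every $\omega\in S^{N-1}$, $$\mathcal K_\beta[Y_k](\omega)=\theta_{k,\beta}\,Y_k(\omega)\qquad\text{and}\qquad \mathcal I_\beta[Y_k](\omega)=\lambda_{k,\beta}\,Y_k(\omega).$$ In particular, $\lim_{k\to+\infty}\lambda_{k,\beta}=2^{1+\frac{\beta}{2}}\,\theta_{0,\beta}$. -/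

import Mathlib

open MeasureTheory Filter Topology

noncomputable section

/-- The unit sphere `S^{N-1}` of Euclidean space `ℝ^N`. -/
abbrev USphere (N : ℕ) : Type :=
  Metric.sphere (0 : EuclideanSpace ℝ (Fin N)) 1

/-- The surface measure on `S^{N-1}` (that is, the `(N-1)`-dimensional Hausdorff measure, normalized
so that `S^{N-1}` has total mass `N` times the Lebesgue measure of the unit ball of `ℝ^N`). -/
def surfaceMeasure (N : ℕ) : Measure (USphere N) :=
  (volume : Measure (EuclideanSpace ℝ (Fin N))).toSphere

/-- The Laplacian `p ↦ ∑ i, ∂²p/∂xᵢ²` on real polynomials in `N` variables. -/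
def polyLaplacian (N : ℕ) : MvPolynomial (Fin N) ℝ →ₗ[ℝ] MvPolynomial (Fin N) ℝ :=
  ∑ i : Fin N, (MvPolynomial.pderiv i).toLinearMap ∘ₗ (MvPolynomial.pderiv i).toLinearMap

/-- Restriction of a polynomial function on `ℝ^N` to the unit sphere. -/
def restrictToSphere (N : ℕ) : MvPolynomial (Fin N) ℝ →ₗ[ℝ] (USphere N → ℝ) where
  toFun p := fun ω => MvPolynomial.eval (fun i => (ω : EuclideanSpace ℝ (Fin N)) i) p
  map_add' p q := by
    funext ω
    simp
  map_smul' c p := by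
    funext ω
    simp

/-- The space of `k`-th spherical harmonics: restrictions to the unit sphere of the harmonic
homogeneous polynomials of degree `k`. -/
def sphericalHarmonics (N k : ℕ) : Submodule ℝ (USphere N → ℝ) :=
  Submodule.map (restrictToSphere N)
    (MvPolynomial.homogeneousSubmodule (Fin N) ℝ k ⊓ LinearMap.ker (polyLaplacian N))

/-- `𝒦_β[u](ω) = 2^{-β/2} ∫_{S^{N-1}} |ω - ξ|^β u(ξ) dξ`. -/
def fracIntegral (N : ℕ) (β : ℝ) (u : USphere N → ℝ) (ω : USphere N) : ℝ :=
  (2 : ℝ) ^ (-(β / 2)) *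
    ∫ ξ : USphere N,
      ‖(ω : EuclideanSpace ℝ (Fin N)) - (ξ : EuclideanSpace ℝ (Fin N))‖ ^ β * u ξ
        ∂(surfaceMeasure N)

/-- `ℐ_β[u](ω) = 2 ∫_{S^{N-1}} |ω - ξ|^β (u(ω) - u(ξ)) dξ`. -/
def marchaudIntegral (N : ℕ) (β : ℝ) (u : USphere N → ℝ) (ω : USphere N) : ℝ :=
  2 * ∫ ξ : USphere N,
      ‖(ω : EuclideanSpace ℝ (Fin N)) - (ξ : EuclideanSpace ℝ (Fin N))‖ ^ β * (u ω - u ξ)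
        ∂(surfaceMeasure N)

/-- The Lebesgue measure of the unit ball of `ℝ^d`. -/
def unitBallVolume (d : ℕ) : ℝ :=
  (volume : Measure (EuclideanSpace ℝ (Fin d))).real (Metric.ball 0 1)

/-- The constant `θ_{k,β}`. The convention is `1 / Γ = 0` at the poles `0, -1, -2, …` of `Γ`, which
is what the Lean expression gives: there `Real.Gamma` is `0`, and division by `0` is `0`. -/
def theta (N k : ℕ) (β : ℝ) : ℝ :=
  ((N : ℝ) - 1) * unitBallVolume (N - 1) * (-1) ^ k *
    ((2 : ℝ) ^ ((β + 2 * N - 4) / 2) * Real.Gamma ((β + N - 1) / 2) *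
        Real.Gamma (((N : ℝ) - 1) / 2) * Real.Gamma ((β + 2) / 2) /
      (Real.Gamma ((β + 2) / 2 - k) * Real.Gamma ((β + 2 * N - 2) / 2 + k)))

/-- The constant `λ_{k,β} = 2^{1+β/2} (θ_{0,β} - θ_{k,β})`. -/
def marchaudEigenvalue (N k : ℕ) (β : ℝ) : ℝ :=
  (2 : ℝ) ^ (1 + β / 2) * (theta N 0 β - theta N k β)

end

/-!
The proof is an elementary version of the Funk–Hecke theorem. On the sphere
`|ω - ξ|² = 2 (1 - ⟪ω, ξ⟫)`, so `𝒦_β` is the operator with zonal kernel `(1 - ⟪ω, ξ⟫) ^ (β / 2)`,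
and `ℐ_β[u] = 2 ^ (1 + β / 2) (𝒦_β[1] u - 𝒦_β[u])`.

*A zonal kernel acts as a scalar on each degree.* If `p` is harmonic and homogeneous of degree `k`,
then `xᵢ p = pᵢ⁺ + a |x|² ∂ᵢp` with `a = 1 / (N + 2 k - 2)`, where `pᵢ⁺` is harmonic of degree
`k + 1` and `∂ᵢp` is harmonic of degree `k - 1`. As `∑ ωᵢ ∂ᵢp(ω) = k p(ω)` by Euler's identity,
multiplying a kernel `f` by `t` turns its scalars `c` into `(1 - a k) c_{k+1} + a k c_{k-1}`
(`zonalIntegral_id_mul_harmonic`). Starting from the kernel `1`, for which the claim is that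
spherical harmonics of positive degree have mean zero (`integral_sphere_harmonic_eq_zero`), this
settles all polynomial kernels, and by Weierstrass approximation all continuous ones
(`exists_isZonalEigenvalue`).

*The value of the scalar.* For `k = 0` it is the total mass of the kernel, which polar and
cylindrical coordinates in `ℝ^N` reduce to a Beta integral (`zonalIntegral_one`). Since
`(1 - t) ^ (b + 1) = (1 - t) ^ b - t (1 - t) ^ b`, the scalars `c_k(b)` satisfy
`c_k(b) - c_k(b + 1) = (1 - a k) c_{k+1}(b) + a k c_{k-1}(b)`, which determines `c_{k+1}` from lower
degrees. The numbers `θ_{k,β}` satisfy the same recurrence (`theta_recurrence`), whence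
`isZonalEigenvalue_theta`.

*The limit.* From `θ_{k+1,β} = θ_{k,β} (k - β / 2) / (k + β / 2 + N - 1)`, the sequence
`k |θ_{k,β}|` is eventually nonincreasing, so `θ_{k,β} → 0` (`tendsto_theta`).
-/

/-! ### Harmonic polynomials -/

section HarmonicPolynomials

open MvPolynomial

/-- The space of real harmonic homogeneous polynomials of degree `k` in `N` variables. -/
noncomputable def harmonicPolynomials (N k : ℕ) : Submodule ℝ (MvPolynomial (Fin N) ℝ) :=
  homogeneousSubmodule (Fin N) ℝ k ⊓ LinearMap.ker (polyLaplacian N)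

lemma mem_harmonicPolynomials {N k : ℕ} {p : MvPolynomial (Fin N) ℝ} :
    p ∈ harmonicPolynomials N k ↔ p.IsHomogeneous k ∧ polyLaplacian N p = 0 := by
  simp [harmonicPolynomials]

/-- The polynomial `∑ i, xᵢ²`. -/
noncomputable def normSqPoly (N : ℕ) : MvPolynomial (Fin N) ℝ := ∑ i, X i ^ 2

lemma polyLaplacian_apply (N : ℕ) (p : MvPolynomial (Fin N) ℝ) :
    polyLaplacian N p = ∑ i, pderiv i (pderiv i p) := by
  simp [polyLaplacian]

lemma pderiv_comm {N : ℕ} (i j : Fin N) (p : MvPolynomial (Fin N) ℝ) :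
    pderiv i (pderiv j p) = pderiv j (pderiv i p) := by
  have h : ⁅(pderiv i : Derivation ℝ (MvPolynomial (Fin N) ℝ) (MvPolynomial (Fin N) ℝ)),
      (pderiv j : Derivation ℝ (MvPolynomial (Fin N) ℝ) (MvPolynomial (Fin N) ℝ))⁆ = 0 := by
    refine MvPolynomial.derivation_ext fun l => ?_
    rw [Derivation.commutator_apply]
    simp only [pderiv_X, Derivation.coe_zero, Pi.zero_apply]
    have hc : ∀ a b : Fin N, pderiv a ((Pi.single b 1 : Fin N → MvPolynomial (Fin N) ℝ) l) = 0 := by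
      intro a b
      rw [Pi.single_apply]
      split_ifs <;> simp
    rw [hc, hc, sub_zero]
  have := congrArg (fun D => D p) h
  rw [Derivation.commutator_apply] at this
  exact sub_eq_zero.mp (by simpa using this)

lemma polyLaplacian_pderiv {N : ℕ} (i : Fin N) (p : MvPolynomial (Fin N) ℝ) :
    polyLaplacian N (pderiv i p) = pderiv i (polyLaplacian N p) := by
  simp only [polyLaplacian_apply, map_sum]
  refine Finset.sum_congr rfl fun j _ => ?_
  rw [pderiv_comm j i p, pderiv_comm j i]

lemma polyLaplacian_X_mul {N : ℕ} (i : Fin N) (p : MvPolynomial (Fin N) ℝ) :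
    polyLaplacian N (X i * p) = X i * polyLaplacian N p + 2 * pderiv i p := by
  simp only [polyLaplacian_apply, Finset.mul_sum]
  have h : ∀ j, pderiv j (pderiv j (X i * p)) =
      X i * pderiv j (pderiv j p) + if j = i then 2 * pderiv i p else 0 := by
    intro j
    rcases eq_or_ne j i with rfl | hj
    · simp; ring
    · simp [pderiv_X_of_ne hj.symm, hj]
  rw [Finset.sum_congr rfl fun j _ => h j, Finset.sum_add_distrib]
  simp

lemma pderiv_normSqPoly {N : ℕ} (i : Fin N) : pderiv i (normSqPoly N) = 2 * X i := by
  have h : ∀ j, pderiv i (X j ^ 2 : MvPolynomial (Fin N) ℝ) = if j = i then 2 * X i else 0 := by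
    intro j
    rcases eq_or_ne j i with rfl | hj
    · simp
    · simp [pderiv_X_of_ne hj, hj]
  simp [normSqPoly, h]

lemma polyLaplacian_normSqPoly_mul {N k : ℕ} {p : MvPolynomial (Fin N) ℝ}
    (hp : p.IsHomogeneous k) :
    polyLaplacian N (normSqPoly N * p) =
      normSqPoly N * polyLaplacian N p + C (2 * N + 4 * k : ℝ) * p := by
  have h : ∀ j, pderiv j (pderiv j (normSqPoly N * p)) =
      normSqPoly N * pderiv j (pderiv j p) + 4 * (X j * pderiv j p) + 2 * p := by
    intro j
    have h2 : pderiv j (2 : MvPolynomial (Fin N) ℝ) = 0 := by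
      rw [← map_ofNat C 2, pderiv_C]
    simp only [pderiv_mul, map_add, pderiv_normSqPoly, h2, pderiv_X_self]
    ring
  simp only [polyLaplacian_apply, h, Finset.sum_add_distrib, ← Finset.mul_sum,
    hp.sum_X_mul_pderiv]
  simp [map_ofNat]
  ring

lemma pderiv_mem_harmonicPolynomials {N k : ℕ} {p : MvPolynomial (Fin N) ℝ}
    (hp : p ∈ harmonicPolynomials N k) (i : Fin N) :
    pderiv i p ∈ harmonicPolynomials N (k - 1) := by
  rw [mem_harmonicPolynomials] at hp ⊢
  exact ⟨hp.1.pderiv, by rw [polyLaplacian_pderiv, hp.2, map_zero]⟩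

/-- The coefficient of `|x|² ∂ᵢp` in the decomposition of `xᵢ p` into harmonic parts, for `p`
harmonic and homogeneous of degree `k`. For `N = 2`, `k = 0` the value is `0⁻¹ = 0`; the
decomposition stays correct since then `∂ᵢp = 0`. -/
noncomputable def harmonicCoeff (N k : ℕ) : ℝ := ((N : ℝ) + 2 * k - 2)⁻¹

lemma harmonicCoeff_succ (N k : ℕ) : harmonicCoeff N (k + 1) = ((N : ℝ) + 2 * k)⁻¹ := by
  unfold harmonicCoeff
  push_cast
  ring_nf

/-- The harmonic projection of `xᵢ p` onto degree `k + 1`, for `p` harmonic and homogeneous of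
degree `k`. -/
noncomputable def harmonicRaise (N k : ℕ) (i : Fin N) (p : MvPolynomial (Fin N) ℝ) :
    MvPolynomial (Fin N) ℝ :=
  X i * p - C (harmonicCoeff N k) * (normSqPoly N * pderiv i p)

lemma harmonicRaise_mem {N k : ℕ} (hN : 2 ≤ N) {p : MvPolynomial (Fin N) ℝ}
    (hp : p ∈ harmonicPolynomials N k) (i : Fin N) :
    harmonicRaise N k i p ∈ harmonicPolynomials N (k + 1) := by
  rw [mem_harmonicPolynomials] at hp ⊢
  obtain ⟨hp, hΔ⟩ := hp
  have hXp : (X i * p).IsHomogeneous (k + 1) := by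
    rw [add_comm]; exact (isHomogeneous_X ℝ i).mul hp
  rcases k with _ | k
  · have h0 : pderiv i p = 0 := by
      rw [← totalDegree_zero_iff_isHomogeneous, totalDegree_eq_zero_iff_eq_C] at hp
      rw [hp, pderiv_C]
    simp only [harmonicRaise, h0, mul_zero, sub_zero]
    exact ⟨hXp, by rw [polyLaplacian_X_mul, hΔ, h0]; simp⟩
  · have hd : (pderiv i p).IsHomogeneous k := by simpa using hp.pderiv (i := i)
    constructor
    · refine hXp.sub ?_
      have hr : (normSqPoly N).IsHomogeneous 2 :=
        IsHomogeneous.sum _ _ _ fun j _ => by simpa using (isHomogeneous_X ℝ j).pow 2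
      have := (isHomogeneous_C (Fin N) (harmonicCoeff N (k + 1))).mul (hr.mul hd)
      rwa [show 0 + (2 + k) = k + 1 + 1 by ring] at this
    · have hc : harmonicCoeff N (k + 1) * (2 * N + 4 * k) = 2 := by
        have : (0 : ℝ) < N := by exact_mod_cast (by omega : 0 < N)
        have hpos : (0 : ℝ) < N + 2 * (k : ℝ) := by positivity
        rw [harmonicCoeff_succ]
        field_simp
        ring
      rw [harmonicRaise, map_sub, polyLaplacian_X_mul, hΔ, ← smul_eq_C_mul, map_smul,
        polyLaplacian_normSqPoly_mul hd, polyLaplacian_pderiv, hΔ, map_zero, mul_zero, mul_zero,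
        zero_add, zero_add, smul_eq_C_mul, ← mul_assoc, ← C_mul, hc]
      simp [map_ofNat]

lemma eval_normSqPoly {N : ℕ} (x : EuclideanSpace ℝ (Fin N)) :
    eval (fun i => x i) (normSqPoly N) = ‖x‖ ^ 2 := by
  simp [normSqPoly, EuclideanSpace.norm_sq_eq]

lemma eval_sphere_normSqPoly {N : ℕ} (ω : USphere N) :
    eval (fun i => (ω : EuclideanSpace ℝ (Fin N)) i) (normSqPoly N) = 1 := by
  rw [eval_normSqPoly]; simp

lemma sum_mul_eval_pderiv {N k : ℕ} {p : MvPolynomial (Fin N) ℝ}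
    (hp : p.IsHomogeneous k) (x : Fin N → ℝ) :
    ∑ i, x i * eval x (pderiv i p) = k * eval x p := by
  simpa using congrArg (eval x) hp.sum_X_mul_pderiv

lemma sum_mul_eval_harmonicRaise {N k : ℕ} {p : MvPolynomial (Fin N) ℝ}
    (hp : p.IsHomogeneous k) (ω : USphere N) :
    ∑ i, (ω : EuclideanSpace ℝ (Fin N)) i *
        eval (fun j => (ω : EuclideanSpace ℝ (Fin N)) j) (harmonicRaise N k i p) =
      (1 - harmonicCoeff N k * k) * eval (fun j => (ω : EuclideanSpace ℝ (Fin N)) j) p := by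
  set x : Fin N → ℝ := fun j => (ω : EuclideanSpace ℝ (Fin N)) j with hx
  have hr : eval x (normSqPoly N) = 1 := eval_sphere_normSqPoly ω
  have hn : ∑ i, x i * x i = 1 := by
    rw [← hr, normSqPoly]
    simp [pow_two]
  have h : ∀ i, x i * eval x (harmonicRaise N k i p) =
      x i * x i * eval x p - harmonicCoeff N k * (x i * eval x (pderiv i p)) := by
    intro i
    simp only [harmonicRaise, map_sub, map_mul, eval_X, eval_C, hr]
    ring
  change ∑ i, x i * _ = _
  rw [Finset.sum_congr rfl fun i _ => h i, Finset.sum_sub_distrib, ← Finset.sum_mul, hn,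
    ← Finset.mul_sum, sum_mul_eval_pderiv hp]
  ring

lemma IsHomogeneous.eval_mul_left {σ : Type*} {k : ℕ} {p : MvPolynomial σ ℝ}
    (hp : p.IsHomogeneous k) (c : ℝ) (x : σ → ℝ) :
    eval (fun i => c * x i) p = c ^ k * eval x p := by
  rw [eval_eq, eval_eq, Finset.mul_sum]
  refine Finset.sum_congr rfl fun d hd => ?_
  have hk : ∑ i ∈ d.support, d i = k := by
    rw [← hp (mem_support_iff.mp hd), Finsupp.weight_apply]
    simp [Finsupp.sum]
  simp only [mul_pow, Finset.prod_mul_distrib, Finset.prod_pow_eq_pow_sum, hk]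
  ring

/-- A homogeneous polynomial that vanishes on the unit sphere is zero. -/
lemma IsHomogeneous.eq_zero_of_sphere {N k : ℕ} {p : MvPolynomial (Fin N) ℝ}
    (hp : p.IsHomogeneous k) (hN : 0 < N)
    (h : ∀ ω : USphere N, eval (fun i => (ω : EuclideanSpace ℝ (Fin N)) i) p = 0) : p = 0 := by
  refine hp.eq_zero_of_forall_eval_eq_zero fun x => ?_
  let y : EuclideanSpace ℝ (Fin N) := WithLp.toLp 2 x
  obtain ⟨ω, hω⟩ : ∃ ω : USphere N, y = ‖y‖ • (ω : EuclideanSpace ℝ (Fin N)) := by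
    by_cases hy : y = 0
    · exact ⟨⟨EuclideanSpace.single ⟨0, hN⟩ 1, by simp⟩, by simp [hy]⟩
    · have hy' : ‖y‖ ≠ 0 := norm_ne_zero_iff.mpr hy
      exact ⟨⟨‖y‖⁻¹ • y, by simp [norm_smul, hy']⟩, by simp [hy']⟩
  have hx : x = fun i => ‖y‖ * (ω : EuclideanSpace ℝ (Fin N)) i := by
    funext i
    exact congrArg (fun z : EuclideanSpace ℝ (Fin N) => z i) hω
  rw [hx, IsHomogeneous.eval_mul_left hp, h, mul_zero]

end HarmonicPolynomials

/-! ### The constants `θ_{k,β}` -/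

lemma inv_Gamma_eq_self_mul_inv_Gamma_add_one (s : ℝ) :
    (Real.Gamma s)⁻¹ = s * (Real.Gamma (s + 1))⁻¹ := by
  rcases eq_or_ne s 0 with rfl | hs
  · simp [Real.Gamma_zero]
  · rw [Real.Gamma_add_one hs, mul_inv, mul_inv_cancel_left₀ hs]

lemma theta_succ {N : ℕ} (k : ℕ) (β : ℝ) (h : β / 2 + N - 1 + k ≠ 0):
    theta N (k + 1) β = theta N k β * ((k - β / 2) / (β / 2 + N - 1 + k)) := by
  have h1 := inv_Gamma_eq_self_mul_inv_Gamma_add_one ((β + 2) / 2 - (k + 1 : ℕ))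
  have h2 := Real.Gamma_add_one h
  rw [show (β + 2) / 2 - ((k + 1 : ℕ) : ℝ) + 1 = (β + 2) / 2 - k by push_cast; ring] at h1
  unfold theta
  rw [show (β + 2 * N - 2) / 2 + ((k + 1 : ℕ) : ℝ) = β / 2 + N - 1 + k + 1 by push_cast; ring,
    show (β + 2 * N - 2) / 2 + (k : ℝ) = β / 2 + N - 1 + k by ring, h2]
  rw [div_eq_mul_inv _ (Real.Gamma _ * (_ * _)), mul_inv, mul_inv, h1,
    div_eq_mul_inv _ (Real.Gamma _ * _), mul_inv]
  push_cast
  ring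

/-- The recurrence that `(1 - t) ^ (β / 2 + 1) = (1 - t) ^ (β / 2) - t (1 - t) ^ (β / 2)` imposes on
the eigenvalues. For `k = 0` the term with `k - 1` has coefficient zero. -/
lemma theta_recurrence {N : ℕ} (hN : 2 ≤ N) (k : ℕ) {β : ℝ} (hβ : 0 < β) :
    (1 - harmonicCoeff N k * k) * theta N (k + 1) β =
      theta N k β - theta N k (β + 2) - harmonicCoeff N k * k * theta N (k - 1) β := by
  have hN' : (2 : ℝ) ≤ N := by exact_mod_cast hN
  set b := β / 2 with hb
  have hb0 : 0 < b := by positivity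
  have hβb : β = 2 * b := by rw [hb]; ring
  -- `P` and `Q` are the values of `1 / Γ` at the rightmost arguments that occur
  set P := (Real.Gamma (b + 2 - k))⁻¹ with hP
  set Q := (Real.Gamma (b + N + k))⁻¹ with hQ
  set A := ((N : ℝ) - 1) * unitBallVolume (N - 1) * (-1) ^ k * ((2 : ℝ) ^ (b + N - 2) *
    Real.Gamma (b + (N - 1) / 2) * Real.Gamma (((N : ℝ) - 1) / 2) * Real.Gamma (b + 1)) with hA
  have e1 : (Real.Gamma (b + 1 - k))⁻¹ = (b + 1 - k) * P := by
    rw [inv_Gamma_eq_self_mul_inv_Gamma_add_one, hP]; ring_nf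
  have e2 : (Real.Gamma (b - k))⁻¹ = (b - k) * (b + 1 - k) * P := by
    rw [inv_Gamma_eq_self_mul_inv_Gamma_add_one, show b - k + 1 = b + 1 - k by ring, e1]; ring
  have e3 : (Real.Gamma (b + N - 1 + k))⁻¹ = (b + N - 1 + k) * Q := by
    rw [inv_Gamma_eq_self_mul_inv_Gamma_add_one, hQ]; ring_nf
  have e4 : (Real.Gamma (b + N - 2 + k))⁻¹ = (b + N - 2 + k) * (b + N - 1 + k) * Q := by
    rw [inv_Gamma_eq_self_mul_inv_Gamma_add_one,
      show b + N - 2 + k + 1 = b + N - 1 + k by ring, e3]; ring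
  have t0 : theta N k β = A * ((b + 1 - k) * (b + N - 1 + k)) * (P * Q) := by
    unfold theta
    rw [hβb, show (2 * b + 2 * N - 4) / 2 = b + N - 2 by ring,
      show (2 * b + N - 1) / 2 = b + (N - 1) / 2 by ring,
      show (2 * b + 2) / 2 = b + 1 by ring,
      show (2 * b + 2 * N - 2) / 2 + (k : ℝ) = b + N - 1 + k by ring]
    rw [div_eq_mul_inv, mul_inv, e1, e3, hA]
    ring
  have t1 : theta N (k + 1) β = - A * ((b - k) * (b + 1 - k)) * (P * Q) := by
    unfold theta
    rw [hβb, show (2 * b + 2 * N - 4) / 2 = b + N - 2 by ring,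
      show (2 * b + N - 1) / 2 = b + (N - 1) / 2 by ring,
      show (2 * b + 2) / 2 = b + 1 by ring,
      show (2 * b + 2 * N - 2) / 2 + ((k + 1 : ℕ) : ℝ) = b + N + k by push_cast; ring,
      show b + 1 - ((k + 1 : ℕ) : ℝ) = b - k by push_cast; ring]
    rw [div_eq_mul_inv, mul_inv, e2, ← hQ, hA]
    ring
  have t2 : theta N k (β + 2) = A * ((2 * b + N - 1) * (b + 1)) * (P * Q) := by
    unfold theta
    rw [hβb, show (2 * b + 2 + 2 * N - 4) / 2 = b + N - 2 + 1 by ring,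
      show (2 * b + 2 + N - 1) / 2 = b + (N - 1) / 2 + 1 by ring,
      show (2 * b + 2 + 2) / 2 = b + 1 + 1 by ring,
      show (2 * b + 2 + 2 * N - 2) / 2 + (k : ℝ) = b + N + k by ring,
      show b + 1 + 1 - (k : ℝ) = b + 2 - k by ring]
    rw [div_eq_mul_inv, mul_inv, ← hQ, ← hP, hA, Real.rpow_add_one (by norm_num),
      Real.Gamma_add_one (by linarith), Real.Gamma_add_one (by linarith)]
    ring
  rcases k with _ | k
  · rw [t0, t1, t2]; push_cast; ring
  · have t3 : theta N (k + 1 - 1) β =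
        - A * ((b + N - 2 + (k + 1 : ℕ)) * (b + N - 1 + (k + 1 : ℕ))) * (P * Q) := by
      unfold theta
      rw [hβb, show (2 * b + 2 * N - 4) / 2 = b + N - 2 by ring,
        show (2 * b + N - 1) / 2 = b + (N - 1) / 2 by ring,
        show (2 * b + 2) / 2 = b + 1 by ring, Nat.add_sub_cancel,
        show (2 * b + 2 * N - 2) / 2 + (k : ℝ) = b + N - 2 + (k + 1 : ℕ) by push_cast; ring,
        show b + 1 - (k : ℝ) = b + 2 - (k + 1 : ℕ) by push_cast; ring]
      rw [div_eq_mul_inv, mul_inv, e4, ← hP, hA]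
      ring
    rw [t0, t1, t2, t3]
    have hpos : (N : ℝ) + 2 * k ≠ 0 := by positivity
    rw [harmonicCoeff_succ]
    push_cast
    field_simp
    ring

lemma one_sub_harmonicCoeff_mul_ne_zero {N : ℕ} (hN : 2 ≤ N) (k : ℕ) :
    1 - harmonicCoeff N k * k ≠ 0 := by
  have hN' : (2 : ℝ) ≤ N := by exact_mod_cast hN
  rcases k with _ | k
  · simp
  · have hpos : (N : ℝ) + 2 * k ≠ 0 := by positivity
    have h : 1 - harmonicCoeff N (k + 1) * ((k + 1 : ℕ) : ℝ) = (N + k - 1) / (N + 2 * k) := by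
      rw [harmonicCoeff_succ]; push_cast; field_simp; ring
    rw [h]
    have : (0 : ℝ) < N + k - 1 := by have := k.cast_nonneg (α := ℝ); linarith
    positivity

/-- The sequence `k |θ_{k,β}|` is eventually nonincreasing, hence bounded. -/
lemma tendsto_theta {N : ℕ} (hN : 2 ≤ N) {β : ℝ} (hβ : 0 < β) :
    Tendsto (fun k : ℕ => theta N k β) atTop (𝓝 0) := by
  have hN' : (2 : ℝ) ≤ N := by exact_mod_cast hN
  obtain ⟨K, hK⟩ := exists_nat_ge (β / 2)
  have hmono : ∀ k ≥ K, (k : ℝ) * |theta N k β| ≤ K * |theta N K β| := by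
    intro k hk
    induction k, hk using Nat.le_induction with
    | base => exact le_rfl
    | succ k hk ih =>
      refine le_trans ?_ ih
      have hkb : β / 2 ≤ k := hK.trans (by exact_mod_cast hk)
      have hd : 0 < β / 2 + N - 1 + k := by have := k.cast_nonneg (α := ℝ); linarith
      rw [theta_succ k β hd.ne', abs_mul, abs_of_nonneg (div_nonneg (by linarith) hd.le)]
      have : ((k + 1 : ℕ) : ℝ) * ((k - β / 2) / (β / 2 + N - 1 + k)) ≤ k := by
        -- `(k + 1) (k - β / 2) ≤ k (k + β / 2 + N - 1)` since `N ≥ 2`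
        rw [← mul_div_assoc, div_le_iff₀ hd]
        push_cast
        nlinarith [k.cast_nonneg (α := ℝ)]
      calc _ = ((k + 1 : ℕ) : ℝ) * ((k - β / 2) / (β / 2 + N - 1 + k)) * |theta N k β| := by ring
        _ ≤ _ := by gcongr
  have hlim : Tendsto (fun k : ℕ => (K * |theta N K β|) / (k : ℝ)) atTop (𝓝 0) :=
    tendsto_const_div_atTop_nhds_zero_nat _
  refine squeeze_zero_norm' ?_ hlim
  filter_upwards [eventually_ge_atTop (max K 1)] with k hk
  have hk1 : (0 : ℝ) < k := by exact_mod_cast (le_max_right K 1).trans hk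
  rw [Real.norm_eq_abs, le_div_iff₀ hk1, mul_comm]
  exact hmono k ((le_max_left K 1).trans hk)

/-! ### Polar coordinates and the mean of a spherical harmonic -/

instance surfaceMeasure_isFiniteMeasure (N : ℕ) : IsFiniteMeasure (surfaceMeasure N) :=
  inferInstanceAs (IsFiniteMeasure (Measure.toSphere _))

/-- Polar coordinates for a product of a function of the direction and a function of the norm. -/
lemma integral_direction_mul_norm {N : ℕ} (hN : 0 < N) (F : EuclideanSpace ℝ (Fin N) → ℝ)
    (u : USphere N → ℝ) (h : ℝ → ℝ)
    (hF : ∀ (ω : USphere N) (r : ℝ), 0 < r →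
      F (r • (ω : EuclideanSpace ℝ (Fin N))) = u ω * h r) :
    ∫ x, F x = (∫ ω, u ω ∂surfaceMeasure N) * ∫ r in Set.Ioi (0 : ℝ), r ^ (N - 1) * h r := by
  have : Nonempty (Fin N) := ⟨⟨0, hN⟩⟩
  calc
    ∫ x, F x = ∫ x : ({(0)}ᶜ : Set (EuclideanSpace ℝ (Fin N))), F x.1
        ∂((volume : Measure (EuclideanSpace ℝ (Fin N))).comap (↑)) := by
      rw [integral_subtype_comap (measurableSet_singleton _).compl fun x ↦ F x,
        restrict_compl_singleton]
    _ = ∫ p, u p.1 * h p.2 ∂(surfaceMeasure N).prod (.volumeIoiPow (N - 1)) := by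
      have := ((volume : Measure (EuclideanSpace ℝ
        (Fin N))).measurePreserving_homeomorphUnitSphereProd).integral_comp
        (Homeomorph.measurableEmbedding _)
        (fun p : USphere N × Set.Ioi (0 : ℝ) => u p.1 * h p.2)
      rw [finrank_euclideanSpace_fin] at this
      rw [surfaceMeasure, ← this]
      refine integral_congr_ae (Eventually.of_forall fun x => ?_)
      have hx := hF (homeomorphUnitSphereProd _ x).1 (homeomorphUnitSphereProd _ x).2
        (homeomorphUnitSphereProd _ x).2.2
      refine Eq.trans ?_ hx
      have h0 : ‖(x : EuclideanSpace ℝ (Fin N))‖ ≠ 0 := norm_ne_zero_iff.mpr x.2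
      simp [smul_smul, h0]
    _ = (∫ ω, u ω ∂surfaceMeasure N) *
        ∫ r : Set.Ioi (0 : ℝ), h r ∂.volumeIoiPow (N - 1) :=
      integral_prod_mul u fun r : Set.Ioi (0 : ℝ) => h r
    _ = _ := by
      congr 1
      simp only [Measure.volumeIoiPow, ENNReal.ofReal]
      rw [integral_withDensity_eq_integral_smul,
        integral_subtype_comap measurableSet_Ioi fun a ↦ Real.toNNReal (a ^ (N - 1)) • h a,
        setIntegral_congr_fun measurableSet_Ioi fun x hx ↦ ?_]
      · rw [NNReal.smul_def, Real.coe_toNNReal _ (pow_nonneg (le_of_lt hx) _), smul_eq_mul]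
      · exact (measurable_subtype_coe.pow_const _).real_toNNReal

lemma integral_Ioi_pow_mul_gaussian_pos (n : ℕ) :
    0 < ∫ r in Set.Ioi (0 : ℝ), r ^ n * Real.exp (-r ^ 2) := by
  have h := integral_rpow_mul_exp_neg_mul_rpow (p := 2) (q := n) (b := 1) (by norm_num)
    (by have := n.cast_nonneg (α := ℝ); linarith) (by norm_num)
  have h' : ∫ r in Set.Ioi (0 : ℝ), r ^ n * Real.exp (-r ^ 2) =
      ∫ r in Set.Ioi (0 : ℝ), r ^ (n : ℝ) * Real.exp (-1 * r ^ (2 : ℝ)) := by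
    refine setIntegral_congr_fun measurableSet_Ioi fun r _ => ?_
    simp [Real.rpow_natCast]
  rw [h', h]
  have : 0 < Real.Gamma (((n : ℝ) + 1) / 2) := Real.Gamma_pos_of_pos (by positivity)
  positivity

section Mean

open MvPolynomial

lemma integrable_pow_mul_gaussian (n : ℕ) :
    Integrable fun t : ℝ => t ^ n * Real.exp (-t ^ 2) := by
  have := integrable_rpow_mul_exp_neg_mul_sq (b := 1) one_pos (s := n)
    (by have := n.cast_nonneg (α := ℝ); linarith)
  simpa [Real.rpow_natCast] using this

lemma integrable_eval_mul_gaussian {N : ℕ} (p : MvPolynomial (Fin N) ℝ) :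
    Integrable fun x : EuclideanSpace ℝ (Fin N) =>
      eval (fun i => x i) p * Real.exp (-‖x‖ ^ 2) := by
  have hm : ∀ d : Fin N →₀ ℕ, Integrable fun x : EuclideanSpace ℝ (Fin N) =>
      (∏ i, x i ^ d i) * Real.exp (-‖x‖ ^ 2) := by
    intro d
    have h1 : Integrable fun x : Fin N → ℝ => ∏ i, (x i ^ d i * Real.exp (-x i ^ 2)) :=
      Integrable.fintype_prod (f := fun i (t : ℝ) => t ^ d i * Real.exp (-t ^ 2))
        fun i => integrable_pow_mul_gaussian (d i)
    have h2 := (PiLp.volume_preserving_ofLp (Fin N)).integrable_comp_of_integrable h1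
    refine h2.congr (Eventually.of_forall fun x => ?_)
    simp [Finset.prod_mul_distrib, ← Real.exp_sum, EuclideanSpace.norm_sq_eq]
  simp only [eval_eq', Finset.sum_mul, mul_assoc]
  exact integrable_finsetSum _ fun d _ => (hm d).const_mul _

lemma hasFDerivAt_eval {N : ℕ} (p : MvPolynomial (Fin N) ℝ) (x : EuclideanSpace ℝ (Fin N)) :
    HasFDerivAt (fun y : EuclideanSpace ℝ (Fin N) => eval (fun i => y i) p)
      (∑ i, eval (fun j => x j) (pderiv i p) • EuclideanSpace.proj (𝕜 := ℝ) i) x := by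
  induction p using MvPolynomial.induction_on with
  | C a => simpa using hasFDerivAt_const a x
  | add p q hp hq =>
    simp only [map_add]
    refine (hp.add hq).congr_fderiv ?_
    simp [add_smul, Finset.sum_add_distrib]
  | mul_X p j hp =>
    have hj : HasFDerivAt (fun y : EuclideanSpace ℝ (Fin N) => y j)
      (EuclideanSpace.proj (𝕜 := ℝ) j) x := (EuclideanSpace.proj (𝕜 := ℝ) j).hasFDerivAt
    have := hp.mul hj
    simp only [map_mul, eval_X]
    refine this.congr_fderiv ?_
    ext v
    simp [Finset.sum_add_distrib, pderiv_X, Pi.single_apply, Finset.mul_sum, add_mul, apply_ite]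
    exact Finset.sum_congr rfl fun i _ => by ring

/-- Gaussian integration by parts for polynomials. -/
lemma integral_X_mul_gaussian {N : ℕ} (p : MvPolynomial (Fin N) ℝ) (i : Fin N) :
    2 * ∫ x : EuclideanSpace ℝ (Fin N), eval (fun i => x i) (X i * p) * Real.exp (-‖x‖ ^ 2) =
      ∫ x : EuclideanSpace ℝ (Fin N), eval (fun i => x i) (pderiv i p) * Real.exp (-‖x‖ ^ 2) := by
  have hg : ∀ x : EuclideanSpace ℝ (Fin N), HasFDerivAt
      (fun y : EuclideanSpace ℝ (Fin N) => Real.exp (-‖y‖ ^ 2))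
      (Real.exp (-‖x‖ ^ 2) • -((2 : ℕ) • (innerSL ℝ x : EuclideanSpace ℝ (Fin N) →L[ℝ] ℝ))) x :=
    fun x =>
    ((hasStrictFDerivAt_norm_sq x).hasFDerivAt.neg).exp
  have hp1 : ∀ x : EuclideanSpace ℝ (Fin N),
      fderiv ℝ (fun y : EuclideanSpace ℝ (Fin N) => eval (fun i => y i) p) x
        (EuclideanSpace.single i 1) = eval (fun i => x i) (pderiv i p) := fun x => by
    rw [(hasFDerivAt_eval p x).fderiv]
    simp
  have hg1 : ∀ x : EuclideanSpace ℝ (Fin N),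
      fderiv ℝ (fun y : EuclideanSpace ℝ (Fin N) => Real.exp (-‖y‖ ^ 2)) x
        (EuclideanSpace.single i 1) = -2 * x i * Real.exp (-‖x‖ ^ 2) := fun x => by
    rw [(hg x).fderiv]
    simp [EuclideanSpace.inner_single_right]
    ring
  have e1 : ∀ x : EuclideanSpace ℝ (Fin N),
      eval (fun i => x i) p * (-2 * x i * Real.exp (-‖x‖ ^ 2)) =
        -2 * (eval (fun i => x i) (X i * p) * Real.exp (-‖x‖ ^ 2)) := fun x => by
    simp; ring
  have key := integral_mul_fderiv_eq_neg_fderiv_mul_of_integrable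
    (μ := (volume : Measure (EuclideanSpace ℝ (Fin N))))
    (f := fun y : EuclideanSpace ℝ (Fin N) => eval (fun i => y i) p)
    (g := fun y : EuclideanSpace ℝ (Fin N) => Real.exp (-‖y‖ ^ 2))
    (v := EuclideanSpace.single i 1)
    (by simp only [hp1]; exact integrable_eval_mul_gaussian _)
    (by simp only [hg1, e1]; exact (integrable_eval_mul_gaussian _).const_mul _)
    (integrable_eval_mul_gaussian _)
    (fun x _ => (hasFDerivAt_eval p x).differentiableAt)
    (fun x _ => (hg x).differentiableAt)
  simp only [hp1, hg1, e1, integral_const_mul] at key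
  linarith

/-- A spherical harmonic of positive degree `k` has mean zero: by Euler's identity and Gaussian
integration by parts, `2 k ∫ p e^{-|x|²} = ∫ (Δp) e^{-|x|²} = 0`. -/
lemma integral_sphere_harmonic_eq_zero {N k : ℕ} (hN : 0 < N) (hk : k ≠ 0)
    {p : MvPolynomial (Fin N) ℝ} (hp : p ∈ harmonicPolynomials N k) :
    ∫ ω, restrictToSphere N p ω ∂surfaceMeasure N = 0 := by
  rw [mem_harmonicPolynomials] at hp
  have h1 : ∑ i, 2 * ∫ x : EuclideanSpace ℝ (Fin N),
      eval (fun i => x i) (X i * pderiv i p) * Real.exp (-‖x‖ ^ 2) = 0 := by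
    simp only [integral_X_mul_gaussian]
    rw [← integral_finsetSum _ fun i _ => integrable_eval_mul_gaussian _]
    simp only [← Finset.sum_mul, ← map_sum, ← polyLaplacian_apply, hp.2]
    simp
  rw [← Finset.mul_sum, ← integral_finsetSum _ fun i _ => integrable_eval_mul_gaussian _] at h1
  simp only [← Finset.sum_mul, ← map_sum, hp.1.sum_X_mul_pderiv] at h1
  simp only [nsmul_eq_mul, map_mul, map_natCast, mul_assoc, integral_const_mul] at h1
  have h2 : ∫ x : EuclideanSpace ℝ (Fin N), eval (fun i => x i) p * Real.exp (-‖x‖ ^ 2) = 0 := by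
    simpa [hk] using h1
  rw [integral_direction_mul_norm hN _ (restrictToSphere N p)
    (fun r => r ^ k * Real.exp (-r ^ 2))] at h2
  · have h3 := integral_Ioi_pow_mul_gaussian_pos (N - 1 + k)
    simp only [← mul_assoc, ← pow_add] at h2
    exact (mul_eq_zero.mp h2).resolve_right h3.ne'
  · intro ω r hr
    have := IsHomogeneous.eval_mul_left hp.1 r (fun i => (ω : EuclideanSpace ℝ (Fin N)) i)
    simp only [PiLp.smul_apply, smul_eq_mul, this, norm_smul, restrictToSphere]
    simp
    ring

end Mean

/-! ### Zonal integral operators -/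

section Zonal

/-- The integral operator on the sphere with kernel `f ⟪ω, ξ⟫`. -/
noncomputable def zonalIntegral (N : ℕ) (f : ℝ → ℝ) (u : USphere N → ℝ) (ω : USphere N) : ℝ :=
  ∫ ξ : USphere N, f (inner ℝ (ω : EuclideanSpace ℝ (Fin N)) ξ) * u ξ ∂surfaceMeasure N

/-- `c` is the factor by which the operator with kernel `f ⟪ω, ξ⟫` multiplies all spherical
harmonics of degree `k`. -/
def IsZonalEigenvalue (N : ℕ) (f : ℝ → ℝ) (k : ℕ) (c : ℝ) : Prop :=
  ∀ p ∈ harmonicPolynomials N k, ∀ ω : USphere N,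
    zonalIntegral N f (restrictToSphere N p) ω = c * restrictToSphere N p ω

variable {N : ℕ}

lemma restrictToSphere_apply (p : MvPolynomial (Fin N) ℝ) (ω : USphere N) :
    restrictToSphere N p ω =
      MvPolynomial.eval (fun i => (ω : EuclideanSpace ℝ (Fin N)) i) p := rfl

lemma continuous_restrictToSphere (p : MvPolynomial (Fin N) ℝ) :
    Continuous (restrictToSphere N p) := by
  change Continuous fun ω : USphere N =>
    MvPolynomial.eval (fun i => (ω : EuclideanSpace ℝ (Fin N)) i) p
  exact p.continuous_eval.comp (by fun_prop)

lemma Continuous.integrable_surfaceMeasure {u : USphere N → ℝ} (hu : Continuous u) :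
    Integrable u (surfaceMeasure N) :=
  hu.integrable_of_hasCompactSupport (HasCompactSupport.of_compactSpace u)

lemma integrable_zonal {f : ℝ → ℝ} (hf : Continuous f) {u : USphere N → ℝ} (hu : Continuous u)
    (ω : USphere N) :
    Integrable (fun ξ : USphere N => f (inner ℝ (ω : EuclideanSpace ℝ (Fin N)) ξ) * u ξ)
      (surfaceMeasure N) :=
  Continuous.integrable_surfaceMeasure
    ((hf.comp (continuous_const.inner continuous_subtype_val)).mul hu)

lemma inner_mem_Icc (ω ξ : USphere N) :
    inner ℝ (ω : EuclideanSpace ℝ (Fin N)) ξ ∈ Set.Icc (-1 : ℝ) 1 := by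
  have h := abs_real_inner_le_norm (ω : EuclideanSpace ℝ (Fin N)) (ξ : EuclideanSpace ℝ (Fin N))
  rw [norm_eq_of_mem_sphere, norm_eq_of_mem_sphere, mul_one] at h
  exact abs_le.mp h

lemma zonalIntegral_id_mul {f : ℝ → ℝ} (hf : Continuous f) (p : MvPolynomial (Fin N) ℝ)
    (ω : USphere N) :
    zonalIntegral N (fun t => t * f t) (restrictToSphere N p) ω =
      ∑ i, (ω : EuclideanSpace ℝ (Fin N)) i *
        zonalIntegral N f (restrictToSphere N (MvPolynomial.X i * p)) ω := by
  simp only [zonalIntegral, ← integral_const_mul]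
  rw [← integral_finsetSum _ fun i _ =>
    (integrable_zonal hf (continuous_restrictToSphere _) ω).const_mul _]
  refine integral_congr_ae (Eventually.of_forall fun ξ => ?_)
  simp only [restrictToSphere_apply, map_mul, MvPolynomial.eval_X]
  rw [PiLp.inner_apply]
  simp only [Finset.sum_mul]
  refine Finset.sum_congr rfl fun i _ => ?_
  simp
  ring

/-- The splitting of `xᵢ p` into harmonic parts under the integral, where `|x|² = 1`. -/
lemma zonalIntegral_X_mul {f : ℝ → ℝ} (hf : Continuous f) (k : ℕ) (p : MvPolynomial (Fin N) ℝ)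
    (i : Fin N) (ω : USphere N) :
    zonalIntegral N f (restrictToSphere N (MvPolynomial.X i * p)) ω =
      zonalIntegral N f (restrictToSphere N (harmonicRaise N k i p)) ω +
        harmonicCoeff N k *
          zonalIntegral N f (restrictToSphere N (MvPolynomial.pderiv i p)) ω := by
  simp only [zonalIntegral, ← integral_const_mul]
  rw [← integral_add (integrable_zonal hf (continuous_restrictToSphere _) ω)
    ((integrable_zonal hf (continuous_restrictToSphere _) ω).const_mul _)]
  refine integral_congr_ae (Eventually.of_forall fun ξ => ?_)
  simp only [restrictToSphere_apply, harmonicRaise, map_mul, map_sub,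
    MvPolynomial.eval_C, eval_sphere_normSqPoly]
  ring

/-- Multiplying the kernel by `t` couples degree `k` to the degrees `k + 1` and `k - 1`. -/
lemma zonalIntegral_id_mul_harmonic (hN : 2 ≤ N) {f : ℝ → ℝ} (hf : Continuous f) {k : ℕ}
    {c₁ c₂ : ℝ} (h₁ : IsZonalEigenvalue N f (k + 1) c₁) (h₂ : IsZonalEigenvalue N f (k - 1) c₂) :
    IsZonalEigenvalue N (fun t => t * f t) k
      ((1 - harmonicCoeff N k * k) * c₁ + harmonicCoeff N k * k * c₂) := by
  intro p hp ω
  have hp' := (mem_harmonicPolynomials.mp hp).1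
  rw [zonalIntegral_id_mul hf]
  have h : ∀ i, (ω : EuclideanSpace ℝ (Fin N)) i *
        zonalIntegral N f (restrictToSphere N (MvPolynomial.X i * p)) ω =
      c₁ * ((ω : EuclideanSpace ℝ (Fin N)) i * restrictToSphere N (harmonicRaise N k i p) ω) +
      harmonicCoeff N k * c₂ *
        ((ω : EuclideanSpace ℝ (Fin N)) i * restrictToSphere N (MvPolynomial.pderiv i p) ω) := by
    intro i
    rw [zonalIntegral_X_mul hf k, h₁ _ (harmonicRaise_mem hN hp i),
      h₂ _ (pderiv_mem_harmonicPolynomials hp i)]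
    ring
  have e₁ : ∑ i, (ω : EuclideanSpace ℝ (Fin N)) i *
      restrictToSphere N (harmonicRaise N k i p) ω =
      (1 - harmonicCoeff N k * k) * restrictToSphere N p ω := sum_mul_eval_harmonicRaise hp' ω
  have e₂ : ∑ i, (ω : EuclideanSpace ℝ (Fin N)) i *
      restrictToSphere N (MvPolynomial.pderiv i p) ω = k * restrictToSphere N p ω :=
    sum_mul_eval_pderiv hp' _
  rw [Finset.sum_congr rfl fun i _ => h i, Finset.sum_add_distrib, ← Finset.mul_sum,
    ← Finset.mul_sum, e₁, e₂]
  ring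

lemma restrictToSphere_apply_of_mem_zero {p : MvPolynomial (Fin N) ℝ}
    (hp : p ∈ harmonicPolynomials N 0) (ω ξ : USphere N) :
    restrictToSphere N p ω = restrictToSphere N p ξ := by
  have h := (mem_harmonicPolynomials.mp hp).1
  rw [← MvPolynomial.totalDegree_zero_iff_isHomogeneous,
    MvPolynomial.totalDegree_eq_zero_iff_eq_C] at h
  rw [h]
  simp [restrictToSphere]

lemma isZonalEigenvalue_zero {f : ℝ → ℝ} {c : ℝ}
    (h : ∀ ω, zonalIntegral N f (fun _ => 1) ω = c) : IsZonalEigenvalue N f 0 c := by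
  intro p hp ω
  rw [← h ω]
  simp only [zonalIntegral, ← integral_mul_const]
  refine integral_congr_ae (Eventually.of_forall fun ξ => ?_)
  simp only [restrictToSphere_apply_of_mem_zero hp ξ ω, mul_one]

lemma exists_isZonalEigenvalue_pow (hN : 2 ≤ N) (m : ℕ) :
    ∀ k, ∃ c, IsZonalEigenvalue N (fun t => t ^ m) k c := by
  induction m with
  | zero =>
    intro k
    rcases eq_or_ne k 0 with rfl | hk
    · exact ⟨(surfaceMeasure N).real Set.univ,
        isZonalEigenvalue_zero fun ω => by simp [zonalIntegral]⟩
    · refine ⟨0, fun p hp ω => ?_⟩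
      simpa [zonalIntegral] using integral_sphere_harmonic_eq_zero (by omega) hk hp
  | succ m ih =>
    intro k
    obtain ⟨c₁, h₁⟩ := ih (k + 1)
    obtain ⟨c₂, h₂⟩ := ih (k - 1)
    simp only [pow_succ']
    exact ⟨_, zonalIntegral_id_mul_harmonic hN (continuous_pow m) h₁ h₂⟩

lemma exists_isZonalEigenvalue_polynomial (hN : 2 ≤ N) (P : Polynomial ℝ) (k : ℕ) :
    ∃ c, IsZonalEigenvalue N (fun t => P.eval t) k c := by
  induction P using Polynomial.induction_on' with
  | add P Q hP hQ =>
    obtain ⟨c, hc⟩ := hP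
    obtain ⟨d, hd⟩ := hQ
    refine ⟨c + d, fun p hp ω => ?_⟩
    rw [add_mul, ← hc p hp, ← hd p hp, zonalIntegral, zonalIntegral, zonalIntegral,
      ← integral_add (integrable_zonal P.continuous (continuous_restrictToSphere _) ω)
        (integrable_zonal Q.continuous (continuous_restrictToSphere _) ω)]
    simp [add_mul]
  | monomial n a =>
    obtain ⟨c, hc⟩ := exists_isZonalEigenvalue_pow hN n k
    refine ⟨a * c, fun p hp ω => ?_⟩
    rw [mul_assoc, ← hc p hp, zonalIntegral, zonalIntegral, ← integral_const_mul]
    simp [mul_assoc]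

lemma abs_zonalIntegral_sub_le {f g : ℝ → ℝ} (hf : Continuous f) (hg : Continuous g) {ε : ℝ}
    (h : ∀ t ∈ Set.Icc (-1 : ℝ) 1, |g t - f t| ≤ ε) {u : USphere N → ℝ} (hu : Continuous u)
    (ω : USphere N) :
    |zonalIntegral N g u ω - zonalIntegral N f u ω| ≤ ε * ∫ ξ, |u ξ| ∂surfaceMeasure N := by
  rw [zonalIntegral, zonalIntegral,
    ← integral_sub (integrable_zonal hg hu ω) (integrable_zonal hf hu ω), ← integral_const_mul,
    ← Real.norm_eq_abs]
  refine norm_integral_le_of_norm_le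
    ((Continuous.integrable_surfaceMeasure hu.abs).const_mul ε) (Eventually.of_forall fun ξ => ?_)
  rw [← sub_mul, Real.norm_eq_abs, abs_mul]
  exact mul_le_mul_of_nonneg_right (h _ (inner_mem_Icc ω ξ)) (abs_nonneg _)

/-- Existence part of the Funk–Hecke theorem: a continuous kernel acts as a scalar on the
spherical harmonics of degree `k`. Being a scalar amounts to the identity
`T[p](ω) q(ξ) = T[q](ξ) p(ω)`, which passes from polynomial kernels to their uniform limits. -/
lemma exists_isZonalEigenvalue (hN : 2 ≤ N) {f : ℝ → ℝ} (hf : Continuous f) (k : ℕ) :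
    ∃ c, IsZonalEigenvalue N f k c := by
  have hP : ∀ n : ℕ, ∃ P : Polynomial ℝ, ∀ t ∈ Set.Icc (-1 : ℝ) 1,
      |P.eval t - f t| < 1 / ((n : ℝ) + 1) := fun n =>
    exists_polynomial_near_of_continuousOn (-1) 1 f hf.continuousOn _ (by positivity)
  choose P hP using hP
  have hlim : ∀ (p : MvPolynomial (Fin N) ℝ) (ω : USphere N),
      Tendsto (fun n => zonalIntegral N (fun t => (P n).eval t) (restrictToSphere N p) ω) atTop
        (𝓝 (zonalIntegral N f (restrictToSphere N p) ω)) := by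
    intro p ω
    rw [tendsto_iff_dist_tendsto_zero]
    refine squeeze_zero (fun _ => dist_nonneg) (fun n => ?_) (?_ : Tendsto (fun n : ℕ =>
      1 / ((n : ℝ) + 1) * ∫ ξ, |restrictToSphere N p ξ| ∂surfaceMeasure N) atTop (𝓝 0))
    · exact abs_zonalIntegral_sub_le hf (P n).continuous (fun t ht => (hP n t ht).le)
        (continuous_restrictToSphere p) ω
    · simpa using tendsto_one_div_add_atTop_nhds_zero_nat.mul_const
        (∫ ξ, |restrictToSphere N p ξ| ∂surfaceMeasure N)
  have hbil : ∀ p ∈ harmonicPolynomials N k, ∀ q ∈ harmonicPolynomials N k, ∀ ω ξ : USphere N,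
      zonalIntegral N f (restrictToSphere N p) ω * restrictToSphere N q ξ =
        zonalIntegral N f (restrictToSphere N q) ξ * restrictToSphere N p ω := by
    intro p hp q hq ω ξ
    refine tendsto_nhds_unique_of_eventuallyEq ((hlim p ω).mul_const _) ((hlim q ξ).mul_const _)
      (Eventually.of_forall fun n => ?_)
    obtain ⟨c, hc⟩ := exists_isZonalEigenvalue_polynomial hN (P n) k
    simp only [hc p hp, hc q hq]
    ring
  by_cases h : ∃ q ∈ harmonicPolynomials N k, ∃ ξ, restrictToSphere N q ξ ≠ 0
  · obtain ⟨q, hq, ξ, hξ⟩ := h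
    refine ⟨zonalIntegral N f (restrictToSphere N q) ξ / restrictToSphere N q ξ, fun p hp ω => ?_⟩
    rw [div_mul_eq_mul_div, eq_div_iff hξ, hbil p hp q hq]
  · push Not at h
    refine ⟨0, fun p hp ω => ?_⟩
    simp [zonalIntegral, h p hp]

end Zonal

/-! ### The total mass of the kernel `(1 - t) ^ b` -/

lemma integral_rpow_mul_one_sub_rpow {a c : ℝ} (ha : 0 < a) (hc : 0 < c) :
    ∫ x in Set.Ioo (0 : ℝ) 1, x ^ (a - 1) * (1 - x) ^ (c - 1) =
      Real.Gamma a * Real.Gamma c / Real.Gamma (a + c) := by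
  change _ = ProbabilityTheory.beta a c
  rw [ProbabilityTheory.beta_eq_betaIntegralReal a c ha hc, Complex.betaIntegral,
    intervalIntegral.integral_of_le (by norm_num), ← integral_Ioc_eq_integral_Ioo,
    ← RCLike.re_to_complex, ← integral_re]
  · refine setIntegral_congr_fun measurableSet_Ioc fun x ⟨hx1, hx2⟩ ↦ ?_
    norm_cast
    rw [← Complex.ofReal_cpow, ← Complex.ofReal_cpow, RCLike.re_to_complex,
      Complex.re_mul_ofReal, Complex.ofReal_re]
    all_goals linarith
  · convert! Complex.betaIntegral_convergent (u := a) (v := c) (by simpa) (by simpa)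
    rw [intervalIntegrable_iff_integrableOn_Ioc_of_le (by simp), IntegrableOn]

/-- The substitution `x = (1 - cos θ) / 2` in the Beta integral. -/
lemma integral_sin_pow_mul_one_sub_cos_rpow {n : ℕ} (hn : 0 < n) {b : ℝ} (hb : 0 ≤ b) :
    ∫ θ in Set.Ioo 0 Real.pi, Real.sin θ ^ (n - 1) * (1 - Real.cos θ) ^ b =
      2 ^ (b + n - 1) * (Real.Gamma (b + n / 2) * Real.Gamma (n / 2) / Real.Gamma (b + n)) := by
  have hn' : (0 : ℝ) < n := by exact_mod_cast hn
  have himage : (fun θ => (1 - Real.cos θ) / 2) '' Set.Ioo 0 Real.pi = Set.Ioo 0 1 := by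
    ext x
    constructor
    · rintro ⟨θ, hθ, rfl⟩
      have h1 : Real.cos θ < 1 := by
        simpa using Real.cos_lt_cos_of_nonneg_of_le_pi le_rfl hθ.2.le hθ.1
      have h2 : -1 < Real.cos θ := by
        simpa using Real.cos_lt_cos_of_nonneg_of_le_pi hθ.1.le le_rfl hθ.2
      constructor <;> linarith
    · rintro ⟨h0, h1⟩
      refine ⟨Real.arccos (1 - 2 * x), ⟨Real.arccos_pos.mpr (by linarith), ?_⟩, ?_⟩
      · exact lt_of_le_of_ne (Real.arccos_le_pi _) fun h => by
          rw [Real.arccos_eq_pi] at h; linarith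
      · simp only
        rw [Real.cos_arccos (by linarith) (by linarith)]
        ring
  have hinj : Set.InjOn (fun θ => (1 - Real.cos θ) / 2) (Set.Ioo 0 Real.pi) := by
    intro x hx y hy h
    simp only at h
    exact Real.injOn_cos (Set.Ioo_subset_Icc_self hx) (Set.Ioo_subset_Icc_self hy) (by linarith)
  have hderiv : ∀ θ ∈ Set.Ioo 0 Real.pi,
      HasDerivWithinAt (fun θ => (1 - Real.cos θ) / 2) (Real.sin θ / 2) (Set.Ioo 0 Real.pi) θ := by
    intro θ _
    have := ((Real.hasDerivAt_cos θ).const_sub 1).div_const 2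
    simpa using this.hasDerivWithinAt
  have hbeta := integral_rpow_mul_one_sub_rpow (a := b + n / 2) (c := n / 2) (by positivity)
    (by positivity)
  rw [← himage, integral_image_eq_integral_abs_deriv_smul measurableSet_Ioo hderiv hinj,
    show b + (n : ℝ) / 2 + n / 2 = b + n by ring] at hbeta
  rw [← hbeta, ← integral_const_mul]
  refine setIntegral_congr_fun measurableSet_Ioo fun θ hθ => ?_
  have hs : 0 < Real.sin θ := Real.sin_pos_of_pos_of_lt_pi hθ.1 hθ.2
  have hc : (1 - Real.cos θ) / 2 ∈ Set.Ioo (0 : ℝ) 1 := himage ▸ ⟨θ, hθ, rfl⟩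
  set y := (1 - Real.cos θ) / 2 with hy
  have hcos : 1 - Real.cos θ = 2 * y := by rw [hy]; ring
  have hy1 : 0 < 1 - y := by linarith [hc.2]
  have hsq : (Real.sin θ / 2) ^ 2 = y * (1 - y) := by
    have := Real.sin_sq_add_cos_sq θ
    rw [hy]; nlinarith
  have hprod : y ^ ((n : ℝ) / 2 - 1) * (1 - y) ^ ((n : ℝ) / 2 - 1) =
      (Real.sin θ / 2) ^ ((n : ℝ) - 2) := by
    rw [← Real.mul_rpow hc.1.le hy1.le, ← hsq, ← Real.rpow_natCast, ← Real.rpow_mul (by positivity)]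
    congr 1
    push_cast
    ring
  have hpow : Real.sin θ ^ (n - 1) =
      2 ^ ((n : ℝ) - 1) * ((Real.sin θ / 2) * (Real.sin θ / 2) ^ ((n : ℝ) - 2)) := by
    have hadd := Real.rpow_add (half_pos hs) 1 ((n : ℝ) - 2)
    rw [Real.rpow_one] at hadd
    rw [← hadd, show 1 + ((n : ℝ) - 2) = n - 1 by ring,
      ← Real.mul_rpow (by norm_num) (by positivity), ← Real.rpow_natCast, Nat.cast_sub hn]
    congr 1
    · ring
    · simp
  simp only [smul_eq_mul]
  rw [hpow, ← hprod, hcos, Real.mul_rpow (by norm_num) hc.1.le, abs_of_pos (by positivity),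
    show b + (n : ℝ) / 2 - 1 = b + (n / 2 - 1) by ring, Real.rpow_add hc.1,
    show b + (n : ℝ) - 1 = b + (n - 1) by ring, Real.rpow_add (by norm_num : (0 : ℝ) < 2)]
  ring

/-- Cylindrical coordinates: the integral of a function of `x₀` and of the norm of the other
coordinates. -/
lemma integral_cylindrical (n : ℕ) (hn : 0 < n) (F : EuclideanSpace ℝ (Fin (n + 1)) → ℝ)
    (hF : Integrable F) (G : ℝ → ℝ → ℝ)
    (hFG : ∀ (t : ℝ) (y : EuclideanSpace ℝ (Fin n)),
      F (WithLp.toLp 2 (Fin.cons t (fun i => y i))) = G t ‖y‖) :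
    ∫ x, F x = n * unitBallVolume n *
      ∫ t, ∫ ρ in Set.Ioi (0 : ℝ), ρ ^ (n - 1) * G t ρ := by
  have : Nonempty (Fin n) := ⟨⟨0, hn⟩⟩
  let e : EuclideanSpace ℝ (Fin (n + 1)) ≃ᵐ ℝ × (Fin n → ℝ) :=
    (MeasurableEquiv.toLp 2 (Fin (n + 1) → ℝ)).symm.trans
      (MeasurableEquiv.piFinSuccAbove (fun _ => ℝ) 0)
  have he : MeasurePreserving e volume volume :=
    (EuclideanSpace.volume_preserving_symm_measurableEquiv_toLp (Fin (n + 1))).trans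
      (volume_preserving_piFinSuccAbove (fun _ => ℝ) 0)
  have hsymm : ∀ (t : ℝ) (y : EuclideanSpace ℝ (Fin n)),
      F (e.symm (t, fun i => y i)) = G t ‖y‖ := by
    intro t y
    rw [← hFG, ← Fin.insertNth_zero']
    rfl
  rw [← he.symm.integral_comp e.symm.measurableEmbedding F]
  have hint : Integrable (fun z => F (e.symm z)) (volume.prod volume) :=
    (he.symm.integrable_comp_emb e.symm.measurableEmbedding).mpr hF
  change ∫ z, F (e.symm z) ∂(volume.prod volume) = _
  rw [integral_prod _ hint, ← integral_const_mul]
  refine integral_congr_ae (Eventually.of_forall fun t => ?_)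
  have h1 := (PiLp.volume_preserving_ofLp (Fin n)).integral_comp
    (MeasurableEquiv.toLp 2 (Fin n → ℝ)).symm.measurableEmbedding (fun z => F (e.symm (t, z)))
  have h2 := integral_fun_norm_addHaar (volume : Measure (EuclideanSpace ℝ (Fin n))) (G t)
  simp only [finrank_euclideanSpace_fin, nsmul_eq_mul, smul_eq_mul] at h2
  simp only
  rw [← h1, unitBallVolume, mul_assoc, ← h2]
  exact integral_congr_ae (Eventually.of_forall fun y => hsymm t y)

/-- Polar coordinates on a half-plane, for a product of a function of the angle and a function of
the radius. -/
lemma integral_halfPlane_polar {n : ℕ} (hn : 0 < n) (a : ℝ → ℝ) (h : ℝ → ℝ) (G : ℝ → ℝ → ℝ)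
    (hG : ∀ r θ : ℝ, 0 < r → G (r * Real.cos θ) (r * Real.sin θ) = a θ * h r)
    (hint : IntegrableOn (fun p : ℝ × ℝ => p.2 ^ (n - 1) * G p.1 p.2)
      (Set.univ ×ˢ Set.Ioi (0 : ℝ))) :
    ∫ t, ∫ ρ in Set.Ioi (0 : ℝ), ρ ^ (n - 1) * G t ρ =
      (∫ r in Set.Ioi (0 : ℝ), r ^ n * h r) *
        ∫ θ in Set.Ioo 0 Real.pi, Real.sin θ ^ (n - 1) * a θ := by
  have h1 : ∫ t, ∫ ρ in Set.Ioi (0 : ℝ), ρ ^ (n - 1) * G t ρ =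
      ∫ p in Set.univ ×ˢ Set.Ioi (0 : ℝ), p.2 ^ (n - 1) * G p.1 p.2 := by
    rw [Measure.volume_eq_prod, setIntegral_prod _ hint]
    simp
  have hm : MeasurableSet (Set.univ ×ˢ Set.Ioi (0 : ℝ) : Set (ℝ × ℝ)) :=
    MeasurableSet.univ.prod measurableSet_Ioi
  rw [h1, ← integral_indicator hm, ← integral_comp_polarCoord_symm]
  have h2 : ∫ θ in Set.Ioo 0 Real.pi, Real.sin θ ^ (n - 1) * a θ =
      ∫ θ in Set.Ioo (-Real.pi) Real.pi,
        (Set.Ioo 0 Real.pi).indicator (fun θ => Real.sin θ ^ (n - 1) * a θ) θ := by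
    rw [setIntegral_indicator measurableSet_Ioo, Set.inter_eq_self_of_subset_right
      (Set.Ioo_subset_Ioo_left (by linarith [Real.pi_pos]))]
  rw [h2, ← setIntegral_prod_mul, ← Measure.volume_eq_prod, polarCoord_target]
  refine setIntegral_congr_fun (measurableSet_Ioi.prod measurableSet_Ioo) fun p hp => ?_
  obtain ⟨r, θ⟩ := p
  obtain ⟨hr, hθ⟩ := hp
  simp only [Set.mem_Ioi] at hr
  simp only [Set.mem_Ioo] at hθ
  simp only [polarCoord_symm_apply, smul_eq_mul]
  by_cases h0 : 0 < θ
  · have hs : 0 < r * Real.sin θ := mul_pos hr (Real.sin_pos_of_pos_of_lt_pi h0 hθ.2)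
    rw [Set.indicator_of_mem (by exact ⟨trivial, hs⟩), Set.indicator_of_mem (by exact ⟨h0, hθ.2⟩)]
    simp only
    rw [hG r θ hr, mul_pow]
    obtain ⟨m, rfl⟩ : ∃ m, n = m + 1 := ⟨n - 1, by omega⟩
    simp only [Nat.add_sub_cancel]
    ring
  · have hs : r * Real.sin θ ≤ 0 := mul_nonpos_of_nonneg_of_nonpos hr.le
      (Real.sin_nonpos_of_nonpos_of_neg_pi_le (not_lt.mp h0) hθ.1.le)
    rw [Set.indicator_of_notMem (fun h => absurd h.2 (not_lt.mpr hs)),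
      Set.indicator_of_notMem (fun h => h0 h.1)]
    ring

/-- A reflection moves the axis `v` to any other vector `w` of the same norm. -/
lemma integral_comp_inner_norm_eq {E : Type*} [NormedAddCommGroup E] [InnerProductSpace ℝ E]
    [FiniteDimensional ℝ E] [MeasurableSpace E] [BorelSpace E] (f : ℝ → ℝ → ℝ) {v w : E}
    (h : ‖v‖ = ‖w‖) :
    ∫ x, f (inner ℝ v x) ‖x‖ = ∫ x, f (inner ℝ w x) ‖x‖ := by
  let R := (ℝ ∙ (v - w))ᗮ.reflection
  have hR : R v = w := Submodule.reflection_sub h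
  rw [← R.measurePreserving.integral_comp R.toMeasurableEquiv.measurableEmbedding
    (fun x => f (inner ℝ w x) ‖x‖)]
  simp only [← hR, R.inner_map_map, R.norm_map]

/-- `∫ (1 - ⟪ω, ξ⟫) ^ b dξ` over the unit sphere of `ℝ^(n+1)`. The integral of
`(1 - ⟪ω, x⟫ / |x|) ^ b e^{-|x|²}` over `ℝ^(n+1)` is computed in polar coordinates, and in
cylindrical coordinates followed by polar coordinates in the half-plane; both contain the same radial factor. -/
lemma zonalIntegral_one {n : ℕ} (hn : 0 < n) {b : ℝ} (hb : 0 ≤ b) (ω : USphere (n + 1)) :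
    zonalIntegral (n + 1) (fun t => (1 - t) ^ b) (fun _ => 1) ω =
      n * unitBallVolume n * (2 ^ (b + n - 1) *
        (Real.Gamma (b + n / 2) * Real.Gamma (n / 2) / Real.Gamma (b + n))) := by
  -- `t / r` rather than `t` keeps the first factor bounded; its value at `r = 0` is irrelevant
  let f : ℝ → ℝ → ℝ := fun t r => (1 - t / r) ^ b * Real.exp (-r ^ 2)
  let e : EuclideanSpace ℝ (Fin (n + 1)) := EuclideanSpace.single 0 1
  -- the Gaussian weighted integral over the whole space, in polar coordinates
  have h1 : ∫ x, f (inner ℝ (ω : EuclideanSpace ℝ (Fin (n + 1))) x) ‖x‖ =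
      zonalIntegral (n + 1) (fun t => (1 - t) ^ b) (fun _ => 1) ω *
        ∫ r in Set.Ioi (0 : ℝ), r ^ n * Real.exp (-r ^ 2) := by
    refine integral_direction_mul_norm (N := n + 1) (by omega) _
      (fun ξ => (1 - inner ℝ (ω : EuclideanSpace ℝ (Fin (n + 1))) ξ) ^ b * 1)
      (fun r => Real.exp (-r ^ 2)) fun ξ r hr => ?_
    simp only [f, norm_smul, norm_eq_of_mem_sphere, inner_smul_right, Real.norm_eq_abs,
      abs_of_pos hr, mul_one]
    rw [mul_div_cancel_left₀ _ hr.ne']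
  -- the same integral in cylindrical coordinates around `e`
  have hbound : ∀ t r : ℝ, |t| ≤ r → ‖(1 - t / r) ^ b‖ ≤ 2 ^ b := by
    intro t r htr
    have hq : |t / r| ≤ 1 := by
      rw [abs_div]
      exact div_le_one_of_le₀ (htr.trans (le_abs_self r)) (abs_nonneg r)
    have := abs_le.mp hq
    rw [Real.norm_of_nonneg (Real.rpow_nonneg (by linarith) _)]
    exact Real.rpow_le_rpow (by linarith) (by linarith) hb
  let G : ℝ → ℝ → ℝ := fun t ρ => f t (√(t ^ 2 + ρ ^ 2))
  have h2 : ∫ x, f (inner ℝ e x) ‖x‖ = n * unitBallVolume n *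
      ∫ t, ∫ ρ in Set.Ioi (0 : ℝ), ρ ^ (n - 1) * G t ρ := by
    refine integral_cylindrical n hn _ ?_ G fun t y => ?_
    · have hg : Integrable fun x : EuclideanSpace ℝ (Fin (n + 1)) => Real.exp (-‖x‖ ^ 2) := by
        simpa using integrable_eval_mul_gaussian (N := n + 1) 1
      refine hg.bdd_mul (c := 2 ^ b) (Measurable.aestronglyMeasurable (by fun_prop))
        (Eventually.of_forall fun x => hbound _ _ ?_)
      simpa [e] using abs_real_inner_le_norm e x
    · have hs : √(∑ i, y i ^ 2) ^ 2 = ∑ i, y i ^ 2 :=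
        Real.sq_sqrt (Finset.sum_nonneg fun i _ => sq_nonneg _)
      simp [f, G, e, EuclideanSpace.norm_eq, Fin.sum_univ_succ, EuclideanSpace.inner_single_left,
        hs]
  have h3 := integral_halfPlane_polar hn (fun θ => (1 - Real.cos θ) ^ b)
    (fun r => Real.exp (-r ^ 2)) G (fun r θ hr => by
      have : √((r * Real.cos θ) ^ 2 + (r * Real.sin θ) ^ 2) = r := by
        rw [show (r * Real.cos θ) ^ 2 + (r * Real.sin θ) ^ 2 =
          r ^ 2 * (Real.sin θ ^ 2 + Real.cos θ ^ 2) by ring, Real.sin_sq_add_cos_sq, mul_one,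
          Real.sqrt_sq hr.le]
      simp only [G, f, this]
      rw [mul_div_cancel_left₀ _ hr.ne']) (by
      have hg : Integrable fun p : ℝ × ℝ =>
          (p.1 ^ 0 * Real.exp (-p.1 ^ 2)) * (p.2 ^ (n - 1) * Real.exp (-p.2 ^ 2)) :=
        (integrable_pow_mul_gaussian 0).mul_prod (integrable_pow_mul_gaussian (n - 1))
      have hg' := hg.bdd_mul (f := fun p : ℝ × ℝ => (1 - p.1 / √(p.1 ^ 2 + p.2 ^ 2)) ^ b)
        (c := 2 ^ b) (Measurable.aestronglyMeasurable (by fun_prop))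
        (Eventually.of_forall fun p => hbound _ _ (Real.abs_le_sqrt (by nlinarith [sq_nonneg p.2])))
      refine (hg'.congr (Eventually.of_forall fun p => ?_)).integrableOn
      have : √(p.1 ^ 2 + p.2 ^ 2) ^ 2 = p.1 ^ 2 + p.2 ^ 2 := Real.sq_sqrt (by positivity)
      simp only [G, f, this, neg_add, Real.exp_add]
      ring)
  have hpos := integral_Ioi_pow_mul_gaussian_pos n
  rw [integral_comp_inner_norm_eq f (w := e) (by simp [e]), h2, h3,
    integral_sin_pow_mul_one_sub_cos_rpow hn hb] at h1
  refine mul_right_cancel₀ hpos.ne' (Eq.trans h1.symm ?_)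
  ring

/-! ### The eigenvalues of `𝒦_β` and `ℐ_β` -/

lemma continuous_one_sub_rpow {b : ℝ} (hb : 0 ≤ b) : Continuous fun t : ℝ => (1 - t) ^ b :=
  (continuous_const.sub continuous_id).rpow_const fun _ => Or.inr hb

/-- On the sphere `|ω - ξ|² = 2 (1 - ⟪ω, ξ⟫)`. -/
lemma norm_sub_rpow {N : ℕ} (β : ℝ) (ω ξ : USphere N) :
    ‖(ω : EuclideanSpace ℝ (Fin N)) - ξ‖ ^ β =
      2 ^ (β / 2) * (1 - inner ℝ (ω : EuclideanSpace ℝ (Fin N)) ξ) ^ (β / 2) := by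
  have h := norm_sub_sq_real (ω : EuclideanSpace ℝ (Fin N)) ξ
  rw [norm_eq_of_mem_sphere, norm_eq_of_mem_sphere] at h
  have h1 := (inner_mem_Icc ω ξ).2
  rw [← Real.mul_rpow (by norm_num) (by linarith),
    show 2 * (1 - inner ℝ (ω : EuclideanSpace ℝ (Fin N)) ξ) =
      ‖(ω : EuclideanSpace ℝ (Fin N)) - ξ‖ ^ 2 by rw [h]; ring,
    ← Real.rpow_natCast, ← Real.rpow_mul (norm_nonneg _)]
  congr 1
  push_cast
  ring

lemma fracIntegral_eq_zonalIntegral {N : ℕ} (β : ℝ) (u : USphere N → ℝ) (ω : USphere N) :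
    fracIntegral N β u ω = zonalIntegral N (fun t => (1 - t) ^ (β / 2)) u ω := by
  simp only [fracIntegral, zonalIntegral, norm_sub_rpow, mul_assoc, integral_const_mul]
  rw [← mul_assoc, ← Real.rpow_add (by norm_num)]
  simp

lemma theta_zero_eq {n : ℕ} {β : ℝ} (hβ : 0 < β) :
    theta (n + 1) 0 β = n * unitBallVolume n * (2 ^ (β / 2 + n - 1) *
      (Real.Gamma (β / 2 + n / 2) * Real.Gamma (n / 2) / Real.Gamma (β / 2 + n))) := by
  have hΓ : Real.Gamma ((β + 2) / 2) ≠ 0 := (Real.Gamma_pos_of_pos (by positivity)).ne'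
  unfold theta
  rw [Nat.add_sub_cancel]
  push_cast
  rw [show (β + 2 * ((n : ℝ) + 1) - 4) / 2 = β / 2 + n - 1 by ring,
    show (β + ((n : ℝ) + 1) - 1) / 2 = β / 2 + n / 2 by ring,
    show (β + 2 * ((n : ℝ) + 1) - 2) / 2 + 0 = β / 2 + n by ring,
    show ((n : ℝ) + 1 - 1) = n by ring, sub_zero, pow_zero]
  rw [mul_comm (Real.Gamma ((β + 2) / 2)) (Real.Gamma (β / 2 + n)), mul_div_mul_right _ _ hΓ]
  ring

/-- If `p` is harmonic and homogeneous of degree `k + 1` and some `p(ω) ≠ 0`, then some partial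
derivative of `p` does not vanish identically on the sphere. -/
lemma exists_pderiv_ne_zero {N k : ℕ} {p : MvPolynomial (Fin N) ℝ}
    (hp : p ∈ harmonicPolynomials N (k + 1)) {ω : USphere N} (hω : restrictToSphere N p ω ≠ 0) :
    ∃ q ∈ harmonicPolynomials N k, ∃ ξ, restrictToSphere N q ξ ≠ 0 := by
  have hN : 0 < N := by
    rcases Nat.eq_zero_or_pos N with rfl | h
    · have := norm_eq_of_mem_sphere ω
      simp [Subsingleton.elim (ω : EuclideanSpace ℝ (Fin 0)) 0] at this
    · exact h
  have hp' := (mem_harmonicPolynomials.mp hp).1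
  by_contra! hq
  refine hω ?_
  have h0 : ∀ i, MvPolynomial.pderiv i p = 0 := fun i => by
    have hi := pderiv_mem_harmonicPolynomials hp i
    exact IsHomogeneous.eq_zero_of_sphere (mem_harmonicPolynomials.mp hi).1 hN (hq _ hi)
  have h := sum_mul_eval_pderiv hp' fun i => (ω : EuclideanSpace ℝ (Fin N)) i
  simp only [h0, map_zero, mul_zero, Finset.sum_const_zero] at h
  exact (mul_eq_zero.mp h.symm).resolve_left (by positivity)

/-- The kernel `(1 - t) ^ (β / 2)` acts on the spherical harmonics of degree `k` as `θ_{k,β}`, for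
all `β > 0` at once. Since `(1 - t) ^ (β / 2 + 1) = (1 - t) ^ (β / 2) - t (1 - t) ^ (β / 2)`, the
scalars in degrees `k` and `k - 1` (the former also at `β + 2`) determine the one in degree
`k + 1`. -/
lemma isZonalEigenvalue_theta {N : ℕ} (hN : 2 ≤ N) (k : ℕ) :
    ∀ β : ℝ, 0 < β → IsZonalEigenvalue N (fun t => (1 - t) ^ (β / 2)) k (theta N k β) := by
  induction k using Nat.strong_induction_on with
  | _ k ih =>
  intro β hβ
  rcases k with _ | k
  · obtain ⟨n, rfl⟩ : ∃ n, N = n + 1 := ⟨N - 1, by omega⟩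
    refine isZonalEigenvalue_zero fun ω => ?_
    rw [zonalIntegral_one (by omega) (by positivity), theta_zero_eq hβ]
  · have hcont := continuous_one_sub_rpow (b := β / 2) (by positivity)
    obtain ⟨c, hc⟩ := exists_isZonalEigenvalue hN hcont (k + 1)
    by_cases hne : ∃ p ∈ harmonicPolynomials N (k + 1), ∃ ω, restrictToSphere N p ω ≠ 0
    · obtain ⟨p, hp, ω, hω⟩ := hne
      obtain ⟨q, hq, ξ, hξ⟩ := exists_pderiv_ne_zero hp hω
      suffices h : c = theta N (k + 1) β by rwa [← h]
      have h1 := zonalIntegral_id_mul_harmonic hN hcont hc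
        (ih (k - 1) (by omega) β hβ) q hq ξ
      have h2 := ih k (by omega) β hβ q hq ξ
      have h3 := ih k (by omega) (β + 2) (by linarith) q hq ξ
      have h4 : zonalIntegral N (fun t => (1 - t) ^ ((β + 2) / 2)) (restrictToSphere N q) ξ =
          zonalIntegral N (fun t => (1 - t) ^ (β / 2)) (restrictToSphere N q) ξ -
          zonalIntegral N (fun t => t * (1 - t) ^ (β / 2)) (restrictToSphere N q) ξ := by
        have hq' := continuous_restrictToSphere q
        have hcont' : Continuous fun t : ℝ => t * (1 - t) ^ (β / 2) := continuous_id.mul hcont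
        rw [zonalIntegral, zonalIntegral, zonalIntegral,
          ← integral_sub (integrable_zonal hcont hq' ξ)
            (integrable_zonal hcont' hq' ξ)]
        refine integral_congr_ae (Eventually.of_forall fun η => ?_)
        simp only
        have := (inner_mem_Icc ξ η).2
        rw [show (β + 2) / 2 = β / 2 + 1 by ring,
          Real.rpow_add_one' (by linarith) (by positivity)]
        ring
      rw [h1, h2, h3, ← sub_mul] at h4
      have h5 := mul_right_cancel₀ hξ h4
      have h6 := theta_recurrence hN k hβ
      refine mul_left_cancel₀ (one_sub_harmonicCoeff_mul_ne_zero hN k) ?_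
      linarith
    · push Not at hne
      intro p hp ω
      simp [zonalIntegral, hne p hp]

theorem mainTheorem4 (N : ℕ) (hN : 2 ≤ N) (β : ℝ) (hβ : 0 < β) :
    (∀ (k : ℕ), ∀ Y ∈ sphericalHarmonics N k, ∀ ω : USphere N,
      fracIntegral N β Y ω = theta N k β * Y ω) ∧
    (∀ (k : ℕ), ∀ Y ∈ sphericalHarmonics N k, ∀ ω : USphere N,
      marchaudIntegral N β Y ω = marchaudEigenvalue N k β * Y ω) ∧
    Tendsto (fun k : ℕ => marchaudEigenvalue N k β) atTop
      (𝓝 ((2 : ℝ) ^ (1 + β / 2) * theta N 0 β)) := by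
  have hb : 0 ≤ β / 2 := by positivity
  have hcont := continuous_one_sub_rpow hb
  refine ⟨fun k Y hY ω => ?_, fun k Y hY ω => ?_, ?_⟩
  · obtain ⟨p, hp, rfl⟩ := hY
    rw [fracIntegral_eq_zonalIntegral]
    exact isZonalEigenvalue_theta hN k β hβ p hp ω
  · obtain ⟨p, hp, rfl⟩ := hY
    have h0 : zonalIntegral N (fun t => (1 - t) ^ (β / 2)) (fun _ => 1) ω = theta N 0 β := by
      have h1 : (1 : MvPolynomial (Fin N) ℝ) ∈ harmonicPolynomials N 0 :=
        mem_harmonicPolynomials.mpr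
          ⟨MvPolynomial.isHomogeneous_one _ _, by simp [polyLaplacian_apply]⟩
      have h2 : restrictToSphere N 1 = fun _ => 1 := by
        funext ξ; simp [restrictToSphere_apply]
      have := isZonalEigenvalue_theta hN 0 β hβ 1 h1 ω
      rwa [h2, mul_one] at this
    have hk := isZonalEigenvalue_theta hN k β hβ p hp ω
    set u := restrictToSphere N p
    have hcu : Continuous u := continuous_restrictToSphere p
    have hsplit : marchaudIntegral N β u ω = 2 * 2 ^ (β / 2) *
        (zonalIntegral N (fun t => (1 - t) ^ (β / 2)) (fun _ => 1) ω * u ω -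
          zonalIntegral N (fun t => (1 - t) ^ (β / 2)) u ω) := by
      rw [marchaudIntegral, zonalIntegral, zonalIntegral, ← integral_mul_const,
        ← integral_sub ((integrable_zonal hcont continuous_const ω).mul_const _)
          (integrable_zonal hcont hcu ω), mul_assoc,
        ← integral_const_mul ((2 : ℝ) ^ (β / 2))]
      congr 1
      refine integral_congr_ae (Eventually.of_forall fun ξ => ?_)
      simp only [norm_sub_rpow]
      ring
    rw [hsplit, h0, hk, marchaudEigenvalue, Real.rpow_add (by norm_num), Real.rpow_one]
    ring
  · simpa [marchaudEigenvalue] using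
      ((tendsto_theta hN hβ).const_sub (theta N 0 β)).const_mul ((2 : ℝ) ^ (1 + β / 2))
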